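/- Let $\mathcal K$ be a field of characteristic zero and let $A_2$ be the free associative unital algebra over $\mathcal K$ on two generators $x_1,x_2$, with bracket $[a,b]=ab-ba$ and right-normed commutators $[a_1,a_2,\dots,a_m]=[a_1,[a_2,\dots,a_m]]$. Let $L_1(A_2)=A_2$ and, for $i\ge 2$, let $L_i(A_2)=[A_2,L_{i-1}(A_2)]$ be the linear span of all brackets $[a,l]$ with $a\in A_2$, $l\in L_{i-1}(A_2)$; let $M_i(A_2)=A_2L_i(A_2)A_2$ be the two-sided ideal generated by $L_i(A_2)$. A pure commutator of length $m\ge 1$ is a nonzero element $[x_{j_1},\dots,x_{j_m}]$ with $j_1,\dots,j_m\in\{1,2\}$ (for $m=1$ it is a generator $x_{j_1}$). An element $p$ has a maximal inclusion in $M_i(A_2)$ if $p\in M_i(A_2)$ and $p\notin M_{i+1}(A_2)$. **Theorem (Finite Generation).** For every $i\ge 2$, let $\mathcal S_i$ be the set of all finite products of pure commutators, each of length at least two, that have a maximal inclusion in $M_i(A_2)$. Then $\mathcal S_i$ is finite, and $M_i(A_2)$ is generated by $\mathcal S_i$ as a two-sided ideal. In particular, $M_i(A_2)$ is finitely generated as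 a two-sided ideal. -/

import Mathlib

namespace LCSIdeals

/-- The free associative unital algebra `A_n` on `n` generators over `K`, with the commutator
bracket `⁅a, b⁆ = a * b - b * a`. -/
abbrev FreeAlg (K : Type*) [Field K] (n : ℕ) : Type _ := FreeAlgebra K (Fin n)

/-- The lower central series `L_1 = A_n`, `L_{i+1} = [A_n, L_i]` (the linear span of the brackets)
of the Lie algebra `A_n`. The index `0` is not used; `L_0 = A_n` by convention. -/
noncomputable def L (K : Type*) [Field K] (n : ℕ) : ℕ → Submodule K (FreeAlg K n)
  | 0 => ⊤
  | 1 => ⊤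
  | i + 2 => Submodule.span K {c | ∃ a : FreeAlg K n, ∃ l ∈ L K n (i + 1), ⁅a, l⁆ = c}

/-- The two-sided ideal `M_i(A_n)` generated by `L_i(A_n)`. -/
noncomputable def M (K : Type*) [Field K] (n i : ℕ) : TwoSidedIdeal (FreeAlg K n) :=
  TwoSidedIdeal.span (L K n i : Set (FreeAlg K n))

/-- `IsGenCommutator K n m a`: `a` is a right-normed commutator
`[x_{j_1}, [x_{j_2}, [..., x_{j_m}]]]` of length `m` with single generators in its slots
(possibly equal to zero). A generator is such a commutator of length one. -/
inductive IsGenCommutator (K : Type*) [Field K] (n : ℕ) : ℕ → FreeAlg K n → Prop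
  | gen (j : Fin n) : IsGenCommutator K n 1 (FreeAlgebra.ι K j)
  | bracket (j : Fin n) (m : ℕ) (a : FreeAlg K n) (ha : IsGenCommutator K n m a) :
      IsGenCommutator K n (m + 1) ⁅FreeAlgebra.ι K j, a⁆

/-- A pure commutator of length `m`; zero does not count. -/
def IsPureCommutator (K : Type*) [Field K] (n m : ℕ) (a : FreeAlg K n) : Prop :=
  IsGenCommutator K n m a ∧ a ≠ 0

/-- `p` is a pure-commutator product all of whose factors have length at least `r`. For `r = 1` this
is the general notion of a pure-commutator product. -/
def IsPureCommutatorProduct (K : Type*) [Field K] (n r : ℕ) (p : FreeAlg K n) : Prop :=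
  ∃ l : List (FreeAlg K n), (∀ a ∈ l, ∃ m, r ≤ m ∧ IsPureCommutator K n m a) ∧ l.prod = p

/-- `p` has a maximal inclusion in `M_i(A_n)`. -/
def HasMaximalInclusion (K : Type*) [Field K] (n i : ℕ) (p : FreeAlg K n) : Prop :=
  p ∈ M K n i ∧ p ∉ M K n (i + 1)

/-- The set `S_i` of all products of pure commutators of length at least two
in `A_2` that have a maximal inclusion in `M_i(A_2)`. -/
def S (K : Type*) [Field K] (i : ℕ) : Set (FreeAlg K 2) :=
  {p | IsPureCommutatorProduct K 2 2 p ∧ HasMaximalInclusion K 2 i p}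

end LCSIdeals

namespace LCSIdeals

open TwoSidedIdeal hiding zero_mem add_mem neg_mem sub_mem

/-! ### The ideals `M_i` -/

section Ideals

variable {K : Type*} [Field K] {n : ℕ}

/-! Give a commutator of length `m` weight `m - 1`, and add weights in products. Then `M_{w+1}` is
exactly the span of the products of weight `w`. One inclusion is formal: brackets raise weight by
the Leibniz rule (`M_le_weightSpan`). The other (`CommProd.mem_M`) needs two variables: `M_2` is
generated by `[x_1, x_2]`, whence `M_2 M_i` and `M_i M_2` lie in `M_{i+1}` and `[A_2, M_i] ⊆
M_{i+1}`.

Factors of length one are moved out of a product. Each move costs a product of the same degree and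
weight `w + 1`; expanding a bracket puts it in the ideal generated by reduced products (all factors
of length at least two) of weight `w` and smaller degree (`CommProd.mem_reducedIdeal_aux`). By
homogeneity the same holds for a reduced product of weight `w` lying in `M_{w+2}`, so descent on
degree leaves only those with maximal inclusion in `M_{w+1}`. Reduced factors have positive weight,
so bounded weight leaves finitely many products. -/

theorem bracket_add (a b c : FreeAlg K n) : ⁅a, b + c⁆ = ⁅a, b⁆ + ⁅a, c⁆ := by
  simp only [Ring.lie_def]; noncomm_ring

theorem add_bracket (a b c : FreeAlg K n) : ⁅a + b, c⁆ = ⁅a, c⁆ + ⁅b, c⁆ := by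
  simp only [Ring.lie_def]; noncomm_ring

theorem bracket_mul (a b c : FreeAlg K n) : ⁅a, b * c⁆ = ⁅a, b⁆ * c + b * ⁅a, c⁆ := by
  simp only [Ring.lie_def]; noncomm_ring

theorem mul_bracket (a b c : FreeAlg K n) : ⁅a * b, c⁆ = ⁅a, c⁆ * b + a * ⁅b, c⁆ := by
  simp only [Ring.lie_def]; noncomm_ring

theorem bracket_zero (a : FreeAlg K n) : ⁅a, (0 : FreeAlg K n)⁆ = 0 := by
  rw [Ring.lie_def, mul_zero, zero_mul, sub_zero]

theorem bracket_self (a : FreeAlg K n) : ⁅a, a⁆ = 0 := by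
  rw [Ring.lie_def, sub_self]

theorem neg_bracket_swap (a b : FreeAlg K n) : -⁅b, a⁆ = ⁅a, b⁆ := by
  rw [Ring.lie_def, Ring.lie_def, neg_sub]

theorem bracket_neg (a b : FreeAlg K n) : ⁅a, -b⁆ = -⁅a, b⁆ := by
  simp only [Ring.lie_def]; noncomm_ring

theorem bracket_smul (r : K) (a b : FreeAlg K n) : ⁅a, r • b⁆ = r • ⁅a, b⁆ := by
  rw [Ring.lie_def, Ring.lie_def, mul_smul_comm, smul_mul_assoc, smul_sub]

theorem lie_mem_L {i : ℕ} (hi : 1 ≤ i) (a : FreeAlg K n) {l : FreeAlg K n} (hl : l ∈ L K n i) :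
    ⁅a, l⁆ ∈ L K n (i + 1) := by
  obtain ⟨i, rfl⟩ : ∃ k, i = k + 1 := ⟨i - 1, by omega⟩
  exact Submodule.subset_span ⟨a, l, hl, rfl⟩

theorem L_le_M (i : ℕ) {l : FreeAlg K n} (hl : l ∈ L K n i) : l ∈ M K n i :=
  subset_span hl

theorem smul_mem_twoSidedIdeal (I : TwoSidedIdeal (FreeAlg K n)) (r : K) {z : FreeAlg K n}
    (hz : z ∈ I) : r • z ∈ I := by
  rw [Algebra.smul_def]
  exact I.mul_mem_left _ _ hz

theorem submodule_span_le_twoSidedIdeal (I : TwoSidedIdeal (FreeAlg K n)) {s : Set (FreeAlg K n)}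
    (hs : ∀ x ∈ s, x ∈ I) {z : FreeAlg K n} (hz : z ∈ Submodule.span K s) : z ∈ I := by
  induction hz using Submodule.span_induction with
  | mem x hx => exact hs x hx
  | zero => exact I.zero_mem
  | add x y _ _ hx hy => exact I.add_mem hx hy
  | smul r x _ hx => exact smul_mem_twoSidedIdeal I r hx

theorem L_le_of_bracket (I : TwoSidedIdeal (FreeAlg K n)) {i : ℕ} (hi : 1 ≤ i)
    (h : ∀ (a l : FreeAlg K n), l ∈ L K n i → ⁅a, l⁆ ∈ I) {z : FreeAlg K n}
    (hz : z ∈ L K n (i + 1)) : z ∈ I := by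
  obtain ⟨i, rfl⟩ : ∃ k, i = k + 1 := ⟨i - 1, by omega⟩
  refine submodule_span_le_twoSidedIdeal I ?_ hz
  rintro _ ⟨a, l, hl, rfl⟩
  exact h a l hl

theorem M_succ_le {i : ℕ} (hi : 1 ≤ i) : M K n (i + 1) ≤ M K n i := by
  refine span_le.2 fun z hz => L_le_of_bracket _ hi (fun a l hl => ?_) hz
  rw [Ring.lie_def]
  exact sub_mem (mul_mem_left _ _ _ (L_le_M i hl)) (mul_mem_right _ _ _ (L_le_M i hl))

theorem M_antitone {i j : ℕ} (hi : 1 ≤ i) (hij : i ≤ j) : M K n j ≤ M K n i := by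
  induction j, hij using Nat.le_induction with
  | base => exact le_rfl
  | succ j hj ih => exact (M_succ_le (hi.trans hj)).trans ih

theorem M_one : M K n 1 = ⊤ :=
  top_le_iff.1 fun _ _ => L_le_M 1 (show _ ∈ (⊤ : Submodule K (FreeAlg K n)) from trivial)

theorem lie_mem_M {i : ℕ} (hi : 1 ≤ i) (a : FreeAlg K n) {l : FreeAlg K n} (hl : l ∈ L K n i) :
    ⁅a, l⁆ ∈ M K n (i + 1) :=
  L_le_M _ (lie_mem_L hi a hl)

theorem lie_lie_mem_M {i : ℕ} (hi : 1 ≤ i) (a b : FreeAlg K n) {l : FreeAlg K n}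
    (hl : l ∈ L K n i) : ⁅a, ⁅b, l⁆⁆ ∈ M K n (i + 1) := by
  have h := lie_mem_M hi b hl
  rw [Ring.lie_def a]
  exact sub_mem (mul_mem_left _ _ _ h) (mul_mem_right _ _ _ h)

end Ideals

/-! ### Products of the ideals `M_i` in two variables -/

section TwoVariables

variable {K : Type*} [Field K]

/-- The commutator of the two generators of `A_2`. -/
noncomputable def genLie (K : Type*) [Field K] : FreeAlg K 2 :=
  ⁅FreeAlgebra.ι K (0 : Fin 2), FreeAlgebra.ι K (1 : Fin 2)⁆

/-- Expanding `[x, [y x, l]]` by Leibniz isolates `[x, y] [x, l]` among double brackets. With only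
two generators, `genLie` is up to sign `[x_j, y]` for either `j`. -/
theorem genLie_mul_lie_ι_mem {i : ℕ} (hi : 1 ≤ i) (j : Fin 2) {l : FreeAlg K 2}
    (hl : l ∈ L K 2 i) : genLie K * ⁅FreeAlgebra.ι K j, l⁆ ∈ M K 2 (i + 2) := by
  have key : ∀ x y : FreeAlg K 2, ⁅x, y⁆ * ⁅x, l⁆ ∈ M K 2 (i + 2) := by
    intro x y
    have e : ⁅x, y⁆ * ⁅x, l⁆ = ⁅x, ⁅y * x, l⁆⁆ - y * ⁅x, ⁅x, l⁆⁆ - ⁅x, ⁅y, l⁆⁆ * x := by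
      simp only [Ring.lie_def]; noncomm_ring
    have h : ∀ a b : FreeAlg K 2, ⁅a, ⁅b, l⁆⁆ ∈ M K 2 (i + 2) := fun a b =>
      lie_mem_M (by omega) a (lie_mem_L hi b hl)
    rw [e]
    exact sub_mem (sub_mem (h _ _) (mul_mem_left _ _ _ (h _ _))) (mul_mem_right _ _ _ (h _ _))
  fin_cases j
  · exact key _ _
  · have e : genLie K = -⁅FreeAlgebra.ι K (1 : Fin 2), FreeAlgebra.ι K (0 : Fin 2)⁆ := by
      rw [genLie, neg_bracket_swap]
    rw [e, neg_mul]
    exact neg_mem (key _ _)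

theorem genLie_mul_lie_mem {i : ℕ} (hi : 1 ≤ i) (u : FreeAlg K 2) :
    ∀ l ∈ L K 2 i, genLie K * ⁅u, l⁆ ∈ M K 2 (i + 2) := by
  induction u using FreeAlgebra.induction with
  | grade0 r =>
    intro l _
    have e : ⁅algebraMap K (FreeAlg K 2) r, l⁆ = 0 := by
      rw [Ring.lie_def, Algebra.commutes, sub_self]
    rw [e, mul_zero]
    exact zero_mem _
  | grade1 j => exact fun l hl => genLie_mul_lie_ι_mem hi j hl
  | mul a b ha hb =>
    intro l hl
    -- Swapping `a` and `[b, l]` keeps `genLie` next to a bracket with `l`; the error is a double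
    -- bracket, already in `M_{i+2}`.
    have e : genLie K * ⁅a * b, l⁆ = genLie K * ⁅b, l⁆ * a + genLie K * ⁅a, ⁅b, l⁆⁆
        + genLie K * ⁅a, l⁆ * b := by
      simp only [Ring.lie_def]; noncomm_ring
    rw [e]
    exact add_mem (add_mem (mul_mem_right _ _ _ (hb l hl))
      (mul_mem_left _ _ _ (lie_mem_M (by omega) a (lie_mem_L hi b hl))))
      (mul_mem_right _ _ _ (ha l hl))
  | add a b ha hb =>
    intro l hl
    rw [add_bracket, mul_add]
    exact add_mem (ha l hl) (hb l hl)

/-- The bracket is a derivation in each slot, so it suffices to check pairs of generators. -/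
theorem lie_mem_span_genLie (a b : FreeAlg K 2) : ⁅a, b⁆ ∈ span {genLie K} := by
  have h01 : genLie K ∈ span {genLie K} := subset_span rfl
  have hgen : ∀ (j : Fin 2) (b : FreeAlg K 2), ⁅FreeAlgebra.ι K j, b⁆ ∈ span {genLie K} := by
    intro j b
    induction b using FreeAlgebra.induction with
    | grade0 r =>
      rw [Ring.lie_def, ← Algebra.commutes, sub_self]
      exact zero_mem _
    | grade1 k =>
      fin_cases j <;> fin_cases k
      · exact (bracket_self (FreeAlgebra.ι K _)).symm ▸ zero_mem _
      · exact h01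
      · exact neg_bracket_swap (FreeAlgebra.ι K (1 : Fin 2)) (FreeAlgebra.ι K 0) ▸ neg_mem h01
      · exact (bracket_self (FreeAlgebra.ι K _)).symm ▸ zero_mem _
    | mul a b ha hb =>
      rw [bracket_mul]
      exact add_mem (mul_mem_right _ _ _ ha) (mul_mem_left _ _ _ hb)
    | add a b ha hb =>
      rw [bracket_add]
      exact add_mem ha hb
  induction a using FreeAlgebra.induction with
  | grade0 r =>
    rw [Ring.lie_def, Algebra.commutes, sub_self]
    exact zero_mem _
  | grade1 k => exact hgen k b
  | mul a c ha hc =>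
    rw [mul_bracket]
    exact add_mem (mul_mem_right _ _ _ ha) (mul_mem_left _ _ _ hc)
  | add a c ha hc =>
    rw [add_bracket]
    exact add_mem ha hc

theorem M_two_le_span_genLie : M K 2 2 ≤ span {genLie K} :=
  span_le.2 fun _ hz => L_le_of_bracket _ le_rfl (fun a l _ => lie_mem_span_genLie a l) hz

theorem lie_mem_M_two (a b : FreeAlg K 2) : ⁅a, b⁆ ∈ M K 2 2 :=
  lie_mem_M le_rfl a (show b ∈ (⊤ : Submodule K (FreeAlg K 2)) from trivial)

theorem genLie_mul_L_mem {i : ℕ} (hi : 1 ≤ i) {l : FreeAlg K 2} (hl : l ∈ L K 2 i) :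
    genLie K * l ∈ M K 2 (i + 1) := by
  obtain ⟨i, rfl⟩ : ∃ k, i = k + 1 := ⟨i - 1, by omega⟩
  -- `L_1` is the whole algebra and is not spanned by brackets, so it is treated apart.
  cases i with
  | zero => exact mul_mem_right _ _ _ (lie_mem_M_two _ _)
  | succ i =>
    induction hl using Submodule.span_induction with
    | mem x hx =>
      obtain ⟨a, l, hl, rfl⟩ := hx
      exact genLie_mul_lie_mem (by omega) a l hl
    | zero => rw [mul_zero]; exact zero_mem _
    | add x y _ _ hx hy => rw [mul_add]; exact add_mem hx hy
    | smul r x _ hx => rw [mul_smul_comm]; exact smul_mem_twoSidedIdeal _ r hx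

theorem L_mul_genLie_mem {i : ℕ} (hi : 1 ≤ i) {l : FreeAlg K 2} (hl : l ∈ L K 2 i) :
    l * genLie K ∈ M K 2 (i + 1) := by
  -- This is the Jacobi identity for `[[x, y], l]`.
  have e : ∀ x y : FreeAlg K 2, l * ⁅x, y⁆ = ⁅x, y⁆ * l - (⁅x, ⁅y, l⁆⁆ - ⁅y, ⁅x, l⁆⁆) := by
    intro x y
    simp only [Ring.lie_def]; noncomm_ring
  rw [genLie, e]
  exact sub_mem (genLie_mul_L_mem hi hl)
    (sub_mem (lie_lie_mem_M hi _ _ hl) (lie_lie_mem_M hi _ _ hl))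

theorem M_two_mul_L_mem {i : ℕ} (hi : 1 ≤ i) {z : FreeAlg K 2} (hz : z ∈ M K 2 2) :
    ∀ l ∈ L K 2 i, z * l ∈ M K 2 (i + 1) := by
  replace hz := M_two_le_span_genLie hz
  induction hz using TwoSidedIdeal.span_induction with
  | mem x hx => obtain rfl := hx; exact fun l hl => genLie_mul_L_mem hi hl
  | zero => intro l _; rw [zero_mul]; exact zero_mem _
  | add x y _ _ hx hy => intro l hl; rw [add_mul]; exact add_mem (hx l hl) (hy l hl)
  | neg x _ hx => intro l hl; rw [neg_mul]; exact neg_mem (hx l hl)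
  | left_absorb a x _ hx => intro l hl; rw [mul_assoc]; exact mul_mem_left _ _ _ (hx l hl)
  | right_absorb a x _ hx =>
    intro l hl
    have e : x * a * l = x * l * a + x * ⁅a, l⁆ := by
      simp only [Ring.lie_def]; noncomm_ring
    rw [e]
    exact add_mem (mul_mem_right _ _ _ (hx l hl)) (mul_mem_left _ _ _ (lie_mem_M hi a hl))

theorem L_mul_M_two_mem {i : ℕ} (hi : 1 ≤ i) {z : FreeAlg K 2} (hz : z ∈ M K 2 2) :
    ∀ l ∈ L K 2 i, l * z ∈ M K 2 (i + 1) := by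
  replace hz := M_two_le_span_genLie hz
  induction hz using TwoSidedIdeal.span_induction with
  | mem x hx => obtain rfl := hx; exact fun l hl => L_mul_genLie_mem hi hl
  | zero => intro l _; rw [mul_zero]; exact zero_mem _
  | add x y _ _ hx hy => intro l hl; rw [mul_add]; exact add_mem (hx l hl) (hy l hl)
  | neg x _ hx => intro l hl; rw [mul_neg]; exact neg_mem (hx l hl)
  | left_absorb a x _ hx =>
    intro l hl
    have e : l * (a * x) = a * (l * x) - ⁅a, l⁆ * x := by
      simp only [Ring.lie_def]; noncomm_ring
    rw [e]
    exact sub_mem (mul_mem_left _ _ _ (hx l hl)) (mul_mem_right _ _ _ (lie_mem_M hi a hl))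
  | right_absorb a x _ hx => intro l hl; rw [← mul_assoc]; exact mul_mem_right _ _ _ (hx l hl)

theorem M_two_mul_M_mem {i : ℕ} (hi : 1 ≤ i) {m : FreeAlg K 2} (hm : m ∈ M K 2 i) :
    ∀ z ∈ M K 2 2, z * m ∈ M K 2 (i + 1) := by
  induction hm using TwoSidedIdeal.span_induction with
  | mem x hx => exact fun z hz => M_two_mul_L_mem hi hz x hx
  | zero => intro z _; rw [mul_zero]; exact zero_mem _
  | add x y _ _ hx hy => intro z hz; rw [mul_add]; exact add_mem (hx z hz) (hy z hz)
  | neg x _ hx => intro z hz; rw [mul_neg]; exact neg_mem (hx z hz)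
  | left_absorb a x _ hx =>
    intro z hz; rw [← mul_assoc]; exact hx _ (mul_mem_right _ _ _ hz)
  | right_absorb a x _ hx => intro z hz; rw [← mul_assoc]; exact mul_mem_right _ _ _ (hx z hz)

theorem M_mul_M_two_mem {i : ℕ} (hi : 1 ≤ i) {m : FreeAlg K 2} (hm : m ∈ M K 2 i) :
    ∀ z ∈ M K 2 2, m * z ∈ M K 2 (i + 1) := by
  induction hm using TwoSidedIdeal.span_induction with
  | mem x hx => exact fun z hz => L_mul_M_two_mem hi hz x hx
  | zero => intro z _; rw [zero_mul]; exact zero_mem _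
  | add x y _ _ hx hy => intro z hz; rw [add_mul]; exact add_mem (hx z hz) (hy z hz)
  | neg x _ hx => intro z hz; rw [neg_mul]; exact neg_mem (hx z hz)
  | left_absorb a x _ hx => intro z hz; rw [mul_assoc]; exact mul_mem_left _ _ _ (hx z hz)
  | right_absorb a x _ hx =>
    intro z hz; rw [mul_assoc]; exact hx _ (mul_mem_left _ _ _ hz)

/-- In two variables, `[A_2, M_i] ⊆ M_{i+1}`. -/
theorem lie_M_mem {i : ℕ} (hi : 1 ≤ i) {m : FreeAlg K 2} (hm : m ∈ M K 2 i) (a : FreeAlg K 2) :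
    ⁅a, m⁆ ∈ M K 2 (i + 1) := by
  induction hm using TwoSidedIdeal.span_induction with
  | mem x hx => exact lie_mem_M hi a hx
  | zero => rw [bracket_zero]; exact zero_mem _
  | add x y _ _ hx hy => rw [bracket_add]; exact add_mem hx hy
  | neg x _ hx => rw [bracket_neg]; exact neg_mem hx
  | left_absorb b x hx ih =>
    rw [bracket_mul]
    exact add_mem (M_two_mul_M_mem hi hx _ (lie_mem_M_two a b)) (mul_mem_left _ _ _ ih)
  | right_absorb b x hx ih =>
    rw [bracket_mul]
    exact add_mem (mul_mem_right _ _ _ ih) (M_mul_M_two_mem hi hx _ (lie_mem_M_two a b))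

end TwoVariables

/-! ### Commutator products with weight and degree -/

section Products

variable {K : Type*} [Field K] {n : ℕ}

theorem IsGenCommutator.one_le {m : ℕ} {c : FreeAlg K n} (hc : IsGenCommutator K n m c) :
    1 ≤ m := by
  cases hc <;> omega

/-- `CommProd r w e p`: `p` is a product of right-normed commutators of generators, each of length
at least `r`, of total degree `e`, and of weight `w`, where a commutator of length `m` has weight
`m - 1`. -/
inductive CommProd {K : Type*} [Field K] {n : ℕ} (r : ℕ) : ℕ → ℕ → FreeAlg K n → Prop
  | one : CommProd r 0 0 1
  | cons {m w e w' e' : ℕ} {c p : FreeAlg K n} (hr : r ≤ m) (hc : IsGenCommutator K n m c)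
      (hp : CommProd r w e p) (hw : w + m = w' + 1) (he : e + m = e') : CommProd r w' e' (c * p)

theorem CommProd.mono {r s w e : ℕ} {p : FreeAlg K n} (hrs : s ≤ r) (hp : CommProd r w e p) :
    CommProd s w e p := by
  induction hp with
  | one => exact .one
  | cons hr hc _ hw he ih => exact .cons (hrs.trans hr) hc ih hw he

theorem CommProd.mul {r w e w' e' : ℕ} {p q : FreeAlg K n} (hp : CommProd r w e p)
    (hq : CommProd r w' e' q) : CommProd r (w + w') (e + e') (p * q) := by
  induction hp with
  | one => simpa using hq
  | cons hr hc _ hw he ih =>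
    rw [mul_assoc]
    exact .cons hr hc ih (by omega) (by omega)

theorem CommProd.of_isGenCommutator {r m w : ℕ} {c : FreeAlg K n} (hr : r ≤ m)
    (hc : IsGenCommutator K n m c) (hw : m = w + 1) : CommProd r w m c := by
  simpa using CommProd.cons hr hc .one (by omega) (zero_add m)

/-- The span of the commutator products with given weight and degree. -/
def commSpan (K : Type*) [Field K] (n r w e : ℕ) : Submodule K (FreeAlg K n) :=
  Submodule.span K {p | CommProd r w e p}

theorem CommProd.mem_commSpan {r w e : ℕ} {p : FreeAlg K n} (hp : CommProd r w e p) :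
    p ∈ commSpan K n r w e :=
  Submodule.subset_span hp

theorem CommProd.lie_mem {r w e : ℕ} {p : FreeAlg K n} (hp : CommProd r w e p) (j : Fin n) :
    ⁅FreeAlgebra.ι K j, p⁆ ∈ commSpan K n r (w + 1) (e + 1) := by
  induction hp with
  | one => simp [Ring.lie_def]
  | @cons m w e w' e' c p hr hc hp hw he ih =>
    rw [bracket_mul]
    refine Submodule.add_mem _
      (CommProd.cons (by omega) (.bracket j m c hc) hp (by omega) (by omega)).mem_commSpan ?_
    have hle : commSpan K n r (w + 1) (e + 1)
        ≤ (commSpan K n r (w' + 1) (e' + 1)).comap (LinearMap.mulLeft K c) :=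
      Submodule.span_le.2 fun q hq =>
        (CommProd.cons hr hc hq (by omega) (by omega)).mem_commSpan
    exact hle ih

/-- If multiplying by `a` on the left sends commutator products into `I`, then `a * ⁅x_j, p⁆`
is in `I`. -/
theorem CommProd.mul_lie_mem {r w e : ℕ} {p : FreeAlg K n} (hp : CommProd r w e p) (j : Fin n)
    (I : TwoSidedIdeal (FreeAlg K n)) (a : FreeAlg K n)
    (h : ∀ q, CommProd r (w + 1) (e + 1) q → a * q ∈ I) :
    a * ⁅FreeAlgebra.ι K j, p⁆ ∈ I := by
  have h1 := hp.lie_mem j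
  rw [commSpan] at h1
  generalize ⁅FreeAlgebra.ι K j, p⁆ = z at h1 ⊢
  induction h1 using Submodule.span_induction with
  | mem x hx => exact h x hx
  | zero => rw [mul_zero]; exact zero_mem _
  | add x y _ _ hx hy => rw [mul_add]; exact add_mem hx hy
  | smul r x _ hx => rw [mul_smul_comm]; exact smul_mem_twoSidedIdeal _ r hx

/-- In two variables, a commutator product of weight `w` lies in `M_{w+1}`. -/
theorem CommProd.mem_M {w e : ℕ} {p : FreeAlg K 2} (hp : CommProd 1 w e p) :
    p ∈ M K 2 (w + 1) := by
  induction e using Nat.strong_induction_on generalizing w p with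
  | _ e IH =>
  cases hp with
  | one => rw [M_one]; trivial
  | @cons m w₁ e₁ _ _ c p hr hc hp hw he =>
    -- Inner induction on the leading commutator: in `[x, c] p = [x, c p] - c [x, p]`, the product
    -- `c p` has lower degree, while `c [x, p]` keeps weight and degree but has a shorter leading
    -- factor.
    induction hc generalizing w₁ e₁ p with
    | gen j =>
      obtain rfl : w₁ = w := by omega
      exact mul_mem_left _ _ _ (IH e₁ (by omega) hp)
    | bracket j m c hc ih =>
      have hm := hc.one_le
      have e0 : ⁅FreeAlgebra.ι K j, c⁆ * p
          = ⁅FreeAlgebra.ι K j, c * p⁆ - c * ⁅FreeAlgebra.ι K j, p⁆ := by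
        simp only [Ring.lie_def]; noncomm_ring
      obtain ⟨w, rfl⟩ : ∃ v, w = v + 1 := ⟨w - 1, by omega⟩
      rw [e0]
      refine sub_mem (lie_M_mem (by omega) (IH (e₁ + m) (by omega)
        (.cons hm hc hp (by omega) rfl)) _) ?_
      exact hp.mul_lie_mem j _ _ fun q hq => ih hm hq (by omega) (by omega)

/-! ### The weight filtration -/

/-- The span of all commutator products of weight `w`, in all degrees. -/
def weightSpan (K : Type*) [Field K] (n w : ℕ) : Submodule K (FreeAlg K n) :=
  Submodule.span K {p | ∃ e, CommProd 1 w e p}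

theorem ι_mul_mem_weightSpan {w : ℕ} (j : Fin n) {z : FreeAlg K n} (hz : z ∈ weightSpan K n w) :
    FreeAlgebra.ι K j * z ∈ weightSpan K n w := by
  have hle : weightSpan K n w
      ≤ (weightSpan K n w).comap (LinearMap.mulLeft K (FreeAlgebra.ι K j)) :=
    Submodule.span_le.2 fun q ⟨e, hq⟩ =>
      Submodule.subset_span ⟨e + 1, .cons le_rfl (.gen j) hq rfl rfl⟩
  exact hle hz

theorem mul_ι_mem_weightSpan {w : ℕ} (j : Fin n) {z : FreeAlg K n} (hz : z ∈ weightSpan K n w) :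
    z * FreeAlgebra.ι K j ∈ weightSpan K n w := by
  have hle : weightSpan K n w
      ≤ (weightSpan K n w).comap (LinearMap.mulRight K (FreeAlgebra.ι K j)) :=
    Submodule.span_le.2 fun q ⟨e, hq⟩ =>
      Submodule.subset_span ⟨e + 1, hq.mul (.of_isGenCommutator le_rfl (.gen j) rfl)⟩
  exact hle hz

theorem mul_mem_weightSpan {w : ℕ} (a : FreeAlg K n) :
    ∀ z ∈ weightSpan K n w, a * z ∈ weightSpan K n w := by
  induction a using FreeAlgebra.induction with
  | grade0 r => intro z hz; rw [← Algebra.smul_def]; exact Submodule.smul_mem _ _ hz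
  | grade1 j => exact fun z hz => ι_mul_mem_weightSpan j hz
  | mul a b ha hb => intro z hz; rw [mul_assoc]; exact ha _ (hb _ hz)
  | add a b ha hb => intro z hz; rw [add_mul]; exact Submodule.add_mem _ (ha z hz) (hb z hz)

theorem mem_weightSpan_mul {w : ℕ} (a : FreeAlg K n) :
    ∀ z ∈ weightSpan K n w, z * a ∈ weightSpan K n w := by
  induction a using FreeAlgebra.induction with
  | grade0 r =>
    intro z hz; rw [← Algebra.commutes, ← Algebra.smul_def]; exact Submodule.smul_mem _ _ hz
  | grade1 j => exact fun z hz => mul_ι_mem_weightSpan j hz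
  | mul a b ha hb => intro z hz; rw [← mul_assoc]; exact hb _ (ha _ hz)
  | add a b ha hb => intro z hz; rw [mul_add]; exact Submodule.add_mem _ (ha z hz) (hb z hz)

theorem lie_ι_mem_weightSpan {w : ℕ} (j : Fin n) {z : FreeAlg K n}
    (hz : z ∈ weightSpan K n w) : ⁅FreeAlgebra.ι K j, z⁆ ∈ weightSpan K n (w + 1) := by
  rw [weightSpan] at hz
  induction hz using Submodule.span_induction with
  | mem x hx =>
    obtain ⟨e, hx⟩ := hx
    have hle : commSpan K n 1 (w + 1) (e + 1) ≤ weightSpan K n (w + 1) :=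
      Submodule.span_mono fun q hq => ⟨e + 1, hq⟩
    exact hle (hx.lie_mem j)
  | zero => rw [bracket_zero]; exact Submodule.zero_mem _
  | add x y _ _ hx hy => rw [bracket_add]; exact Submodule.add_mem _ hx hy
  | smul r x _ hx => rw [bracket_smul]; exact Submodule.smul_mem _ _ hx

theorem lie_mem_weightSpan {w : ℕ} (a : FreeAlg K n) :
    ∀ z ∈ weightSpan K n w, ⁅a, z⁆ ∈ weightSpan K n (w + 1) := by
  induction a using FreeAlgebra.induction with
  | grade0 r =>
    intro z _
    rw [Ring.lie_def, Algebra.commutes, sub_self]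
    exact Submodule.zero_mem _
  | grade1 j => exact fun z hz => lie_ι_mem_weightSpan j hz
  | mul a b ha hb =>
    intro z hz
    rw [mul_bracket]
    exact Submodule.add_mem _ (mem_weightSpan_mul b _ (ha z hz)) (mul_mem_weightSpan a _ (hb z hz))
  | add a b ha hb => intro z hz; rw [add_bracket]; exact Submodule.add_mem _ (ha z hz) (hb z hz)

theorem L_le_weightSpan (w : ℕ) : L K n (w + 1) ≤ weightSpan K n w := by
  induction w with
  | zero =>
    intro z _
    rw [← mul_one z]
    exact mul_mem_weightSpan z _ (Submodule.subset_span ⟨0, .one⟩)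
  | succ w ih =>
    refine Submodule.span_le.2 ?_
    rintro _ ⟨a, l, hl, rfl⟩
    exact lie_mem_weightSpan a l (ih hl)

theorem M_le_weightSpan {w : ℕ} {z : FreeAlg K n} (hz : z ∈ M K n (w + 1)) :
    z ∈ weightSpan K n w := by
  induction hz using TwoSidedIdeal.span_induction with
  | mem x hx => exact L_le_weightSpan w hx
  | zero => exact Submodule.zero_mem _
  | add x y _ _ hx hy => exact Submodule.add_mem _ hx hy
  | neg x _ hx => exact Submodule.neg_mem _ hx
  | left_absorb a x _ hx => exact mul_mem_weightSpan a x hx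
  | right_absorb a x _ hx => exact mem_weightSpan_mul a x hx

/-! ### Reduction to factors of length at least two -/

/-- The ideal generated by the commutator products of weight `w` and degree less than `e` whose
factors all have length at least two. -/
def reducedIdeal (K : Type*) [Field K] (n w e : ℕ) : TwoSidedIdeal (FreeAlg K n) :=
  span {p | ∃ e' < e, CommProd 2 w e' p}

theorem reducedIdeal_mono {w e e' : ℕ} (h : e ≤ e') :
    reducedIdeal K n w e ≤ reducedIdeal K n w e' :=
  TwoSidedIdeal.span_mono fun _ ⟨d, hd, hp⟩ => ⟨d, hd.trans_le h, hp⟩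

/-- Opening the leading bracket loses one unit of weight and of degree, except for the term `c [x,
p]`, whose leading factor is shorter. -/
theorem reducedIdeal_of_succ_weight {e : ℕ}
    (h₁ : ∀ d < e, ∀ (w : ℕ) (p : FreeAlg K n), CommProd 1 w d p → p ∈ reducedIdeal K n w (d + 1))
    (h₂ : ∀ d < e, ∀ (w : ℕ) (p : FreeAlg K n), CommProd 1 (w + 1) d p → p ∈ reducedIdeal K n w d)
    {w : ℕ} {p : FreeAlg K n} (hp : CommProd 1 (w + 1) e p) : p ∈ reducedIdeal K n w e := by
  cases hp with
  | @cons m w₁ e₁ _ _ c p hr hc hp hw he =>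
    induction hc generalizing w₁ e₁ p with
    | gen j =>
      obtain rfl : w₁ = w + 1 := by omega
      exact mul_mem_left _ _ _ (reducedIdeal_mono (by omega) (h₂ e₁ (by omega) w p hp))
    | bracket j m c hc ih =>
      have hm := hc.one_le
      have hcp : c * p ∈ reducedIdeal K n w e :=
        reducedIdeal_mono (by omega)
          (h₁ (e₁ + m) (by omega) w _ (.cons hm hc hp (by omega) rfl))
      have e0 : ⁅FreeAlgebra.ι K j, c⁆ * p = FreeAlgebra.ι K j * (c * p)
          - (c * p) * FreeAlgebra.ι K j - c * ⁅FreeAlgebra.ι K j, p⁆ := by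
        simp only [Ring.lie_def]; noncomm_ring
      rw [e0]
      exact sub_mem (sub_mem (mul_mem_left _ _ _ hcp) (mul_mem_right _ _ _ hcp))
        (hp.mul_lie_mem j _ _ fun q hq => ih hm hq (by omega) (by omega))

/-- Here `q` is the prefix already cleared of generators. A generator met next is moved to the far
right, and its correction `q [x, p]` has weight `w + 1` and falls under `h₂`. -/
theorem reducedIdeal_of_weight {e : ℕ}
    (h₁ : ∀ d < e, ∀ (w : ℕ) (p : FreeAlg K n), CommProd 1 w d p → p ∈ reducedIdeal K n w (d + 1))
    (h₂ : ∀ (w : ℕ) (p : FreeAlg K n), CommProd 1 (w + 1) e p → p ∈ reducedIdeal K n w e)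
    {w w₁ e₁ w₂ e₂ : ℕ} {q p : FreeAlg K n} (hq : CommProd 2 w₁ e₁ q) (hp : CommProd 1 w₂ e₂ p)
    (hw : w₁ + w₂ = w) (he : e₁ + e₂ = e) : q * p ∈ reducedIdeal K n w (e + 1) := by
  induction hp generalizing w₁ e₁ q with
  | one =>
    obtain rfl : w₁ = w := by omega
    obtain rfl : e₁ = e := by omega
    rw [mul_one]
    exact subset_span ⟨e₁, by omega, hq⟩
  | @cons m w₃ e₃ w₂ e₂ c p hr hc hp hw' he' ih =>
    by_cases hm : 2 ≤ m
    · rw [← mul_assoc]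
      exact ih (hq.mul (.of_isGenCommutator (w := m - 1) hm hc (by omega))) (by omega) (by omega)
    · cases hc with
      | gen j =>
        have hq1 : CommProd 1 w₁ e₁ q := hq.mono (by omega)
        have e0 : q * (FreeAlgebra.ι K j * p)
            = q * p * FreeAlgebra.ι K j + q * ⁅FreeAlgebra.ι K j, p⁆ := by
          simp only [Ring.lie_def]; noncomm_ring
        rw [e0]
        refine add_mem (mul_mem_right _ _ _ ?_) (hp.mul_lie_mem j _ _ fun s hs => ?_)
        · have h := hq1.mul hp
          rw [show w₁ + w₃ = w by omega] at h
          exact reducedIdeal_mono (by omega) (h₁ _ (by omega) w _ h)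
        · have h := hq1.mul hs
          rw [show w₁ + (w₃ + 1) = w + 1 by omega, show e₁ + (e₃ + 1) = e by omega] at h
          exact reducedIdeal_mono (by omega) (h₂ w _ h)
      | bracket j m c hc =>
        have := hc.one_le
        omega

theorem CommProd.mem_reducedIdeal_aux (e : ℕ) :
    (∀ (w : ℕ) (p : FreeAlg K n), CommProd 1 w e p → p ∈ reducedIdeal K n w (e + 1)) ∧
      ∀ (w : ℕ) (p : FreeAlg K n), CommProd 1 (w + 1) e p → p ∈ reducedIdeal K n w e := by
  induction e using Nat.strong_induction_on with
  | _ e IH =>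
  have h₂ : ∀ (w : ℕ) (p : FreeAlg K n), CommProd 1 (w + 1) e p → p ∈ reducedIdeal K n w e :=
    fun w p hp => reducedIdeal_of_succ_weight (fun d hd => (IH d hd).1) (fun d hd => (IH d hd).2) hp
  refine ⟨fun w p hp => ?_, h₂⟩
  rw [← one_mul p]
  exact reducedIdeal_of_weight (fun d hd => (IH d hd).1) h₂ .one hp (zero_add w) (zero_add e)

/-! ### Homogeneous components -/

open Polynomial in
/-- The homomorphism `A_n → A_n[X]` with `x_j ↦ x_j X`; its coefficients are the homogeneous
components. -/
noncomputable def gradingHom (K : Type*) [Field K] (n : ℕ) : FreeAlg K n →ₐ[K] (FreeAlg K n)[X] :=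
  FreeAlgebra.lift K fun j => monomial 1 (FreeAlgebra.ι K j)

theorem IsGenCommutator.gradingHom_eq {m : ℕ} {c : FreeAlg K n} (hc : IsGenCommutator K n m c) :
    gradingHom K n c = Polynomial.monomial m c := by
  induction hc with
  | gen j => simp [gradingHom]
  | bracket j m c hc ih =>
    have h : gradingHom K n (FreeAlgebra.ι K j) = Polynomial.monomial 1 (FreeAlgebra.ι K j) := by
      simp [gradingHom]
    rw [Ring.lie_def, map_sub, map_mul, map_mul, h, ih, Polynomial.monomial_mul_monomial,
      Polynomial.monomial_mul_monomial, add_comm 1 m, ← map_sub]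

theorem CommProd.gradingHom_eq {r w e : ℕ} {p : FreeAlg K n} (hp : CommProd r w e p) :
    gradingHom K n p = Polynomial.monomial e p := by
  induction hp with
  | one => rw [map_one, Polynomial.monomial_zero_one]
  | cons hr hc hp hw he ih =>
    rw [map_mul, hc.gradingHom_eq, ih, Polynomial.monomial_mul_monomial, add_comm, he]

/-- The weight spans forget degree; taking components recovers it, which the descent on degree
requires. -/
theorem coeff_gradingHom_mem {w : ℕ} {z : FreeAlg K n} (hz : z ∈ weightSpan K n w) (e : ℕ) :
    (gradingHom K n z).coeff e ∈ commSpan K n 1 w e := by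
  rw [weightSpan] at hz
  induction hz using Submodule.span_induction with
  | mem x hx =>
    obtain ⟨d, hx⟩ := hx
    rw [hx.gradingHom_eq, Polynomial.coeff_monomial]
    split_ifs with h
    · exact (h ▸ hx).mem_commSpan
    · exact Submodule.zero_mem _
  | zero => simp
  | add x y _ _ hx hy =>
    rw [map_add, Polynomial.coeff_add]
    exact Submodule.add_mem _ hx hy
  | smul r x _ hx =>
    rw [map_smul, Polynomial.coeff_smul]
    exact Submodule.smul_mem _ _ hx

/-- A commutator product of degree `e` in `M_{w+2}` lies in the ideal generated by reduced
commutator products of weight `w` and smaller degree. -/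
theorem CommProd.mem_reducedIdeal {r v w e : ℕ} {p : FreeAlg K n} (hp : CommProd r v e p)
    (hM : p ∈ M K n (w + 2)) : p ∈ reducedIdeal K n w e := by
  have h := coeff_gradingHom_mem (M_le_weightSpan hM) e
  rw [hp.gradingHom_eq, Polynomial.coeff_monomial_same] at h
  exact submodule_span_le_twoSidedIdeal _ (fun q hq => (CommProd.mem_reducedIdeal_aux e).2 w q hq) h

/-! ### Pure commutator products -/

theorem CommProd.eq_zero_or_isPureCommutatorProduct {r w e : ℕ} {p : FreeAlg K n}
    (hp : CommProd r w e p) : p = 0 ∨ IsPureCommutatorProduct K n r p := by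
  induction hp with
  | one => exact .inr ⟨[], by simp, rfl⟩
  | @cons m w e w' e' c p hr hc hp hw he ih =>
    rcases ih with rfl | ⟨l, hl, rfl⟩
    · exact .inl (mul_zero c)
    · by_cases h0 : c = 0
      · exact .inl (by rw [h0, zero_mul])
      · refine .inr ⟨c :: l, ?_, List.prod_cons⟩
        rintro a (_ | ⟨_, ha⟩)
        exacts [⟨m, hr, hc, h0⟩, hl a ha]

theorem IsPureCommutatorProduct.exists_commProd {r : ℕ} {p : FreeAlg K n}
    (hp : IsPureCommutatorProduct K n r p) : ∃ w e, CommProd r w e p := by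
  obtain ⟨l, hl, rfl⟩ := hp
  induction l with
  | nil => exact ⟨0, 0, .one⟩
  | cons c l ih =>
    obtain ⟨w, e, h⟩ := ih fun a ha => hl a (List.mem_cons_of_mem _ ha)
    obtain ⟨m, hr, hc, _⟩ := hl c List.mem_cons_self
    have := hc.one_le
    exact ⟨w + m - 1, e + m, by
      rw [List.prod_cons]; exact .cons hr hc h (by omega) rfl⟩

theorem finite_isGenCommutator (m : ℕ) : {c : FreeAlg K n | IsGenCommutator K n m c}.Finite := by
  induction m with
  | zero =>
    convert Set.finite_empty
    exact Set.eq_empty_of_forall_notMem fun c hc => absurd (IsGenCommutator.one_le hc) (by omega)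
  | succ m ih =>
    refine ((Set.finite_range fun j : Fin n => FreeAlgebra.ι K j).union
      (Set.Finite.image2 (fun (j : Fin n) a => ⁅FreeAlgebra.ι K j, a⁆) Set.finite_univ ih)).subset ?_
    intro c hc
    cases hc with
    | gen j => exact .inl ⟨j, rfl⟩
    | bracket j _ a ha => exact .inr ⟨j, trivial, a, ha, rfl⟩

theorem finite_commProd (w : ℕ) : {p : FreeAlg K n | ∃ e, CommProd 2 w e p}.Finite := by
  induction w using Nat.strong_induction_on with
  | _ w IH =>
  -- A first factor of length at least two has positive weight, so the remaining factors have weight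
  -- `v < w`, and `v` fixes its length.
  have hfin : (⋃ v ∈ {v | v < w}, Set.image2 (fun c p => c * p)
      {c : FreeAlg K n | IsGenCommutator K n (w + 1 - v) c}
      {p : FreeAlg K n | ∃ e, CommProd 2 v e p}).Finite :=
    (Set.finite_lt_nat w).biUnion fun v hv => (finite_isGenCommutator _).image2 _ (IH v hv)
  refine (hfin.insert 1).subset ?_
  rintro p ⟨e, hp⟩
  cases hp with
  | one => exact .inl rfl
  | @cons m v e₁ _ _ c p hr hc hp hw he =>
    obtain rfl : m = w + 1 - v := by omega
    exact .inr (Set.mem_biUnion (show v < w by omega) ⟨c, hc, p, ⟨e₁, hp⟩, rfl⟩)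

theorem finite_S (i : ℕ) : (S K i).Finite := by
  refine ((Set.finite_lt_nat i).biUnion fun w _ => finite_commProd (K := K) (n := 2) w).subset ?_
  rintro p ⟨hp, -, hM⟩
  obtain ⟨w, e, hp⟩ := hp.exists_commProd
  refine Set.mem_biUnion (show w < i from ?_) ⟨e, hp⟩
  -- Weight at least `i` would place `p` in `M_{i+1}`.
  by_contra h
  exact hM (M_antitone (by omega) (by omega) (hp.mono (by omega)).mem_M)

/-- Descent on degree: a product whose inclusion is not maximal is expressed through products of the
same weight and smaller degree. -/
theorem CommProd.mem_span_S {w e : ℕ} {p : FreeAlg K 2} (hp : CommProd 2 w e p) :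
    p ∈ span (S K (w + 1)) := by
  induction e using Nat.strong_induction_on generalizing p with
  | _ e IH =>
  by_cases hM : p ∈ M K 2 (w + 2)
  · have hle : reducedIdeal K 2 w e ≤ span (S K (w + 1)) :=
      span_le.2 fun q ⟨d, hd, hq⟩ => IH d hd hq
    exact hle (hp.mem_reducedIdeal hM)
  · rcases hp.eq_zero_or_isPureCommutatorProduct with rfl | h
    · exact zero_mem _
    · exact subset_span ⟨h, (hp.mono (by omega)).mem_M, hM⟩

theorem M_le_span_S (w : ℕ) : M K 2 (w + 1) ≤ span (S K (w + 1)) := by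
  intro z hz
  refine submodule_span_le_twoSidedIdeal _ ?_ (M_le_weightSpan hz)
  rintro p ⟨e, hp⟩
  have hle : reducedIdeal K 2 w (e + 1) ≤ span (S K (w + 1)) :=
    span_le.2 fun q ⟨d, _, hq⟩ => hq.mem_span_S
  exact hle ((CommProd.mem_reducedIdeal_aux e).1 w p hp)

end Products

end LCSIdeals

theorem mainTheorem6 (K : Type*) [Field K] [CharZero K] (i : ℕ) (hi : 2 ≤ i) :
    (LCSIdeals.S K i).Finite ∧ TwoSidedIdeal.span (LCSIdeals.S K i) = LCSIdeals.M K 2 i := by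
  obtain ⟨w, rfl⟩ : ∃ w, i = w + 1 := ⟨i - 1, by omega⟩
  exact ⟨LCSIdeals.finite_S _,
    le_antisymm (TwoSidedIdeal.span_le.2 fun _ hp => hp.2.1) (LCSIdeals.M_le_span_S w)⟩
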